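/- Fix a prime number $p$ and a positive integer $r$. For a positive integer $x$, let $\nu_p(x)$ be the exponent of $p$ in $x$ and let $\Theta_p(x) = x/p^{\nu_p(x)}$; for integers $i, x \ge 0$ let $\psi_i(x) = \Theta_p((p^i x)!)$. For rational numbers set $\nu_p(u/v) = \nu_p(u) - \nu_p(v)$ and $\nu_p(0) = \infty$. Let $\mathcal{A}$ be the finite alphabet whose letters are the multisets of size $r$ consisting of digits in base $p$. For a letter $I$, let $\varrho(I)$ be the set of all vectors of length $r$ whose components form a permutation of the multiset $I$, and call $I$ special when $p$ divides $|\varrho(I)|$. For a word $T$ over $\mathcal{A}$, let $\lambda(T)$ be the number of occurrences of special letters in $T$. A vector $\mathbf{x} = (x_1, \ldots, x_r)$ of nonnegative integers is of type $T$ when every $x_i$ can be written in base $p$ with $|T|$ digits (leading zeroes allowed) and, in the matrix with $r$ rows and $|T|$ columns whose row $i$ is this expansion of $x_i$ (most significant digit first), the multisets of the entries of the columns, read from left to right, form the word $T$. Let $P$ be a symmetric polynomial in $r$ variables with integer coefficients and let $\mathbf{e} = (e_0, e_1, \ldots, e_k)$ be a vector of arbitrary (possibly negative) integers. For a word $T$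 over $\mathcal{A}$ put \[\mathfrak{S}^{\mathbf{e}}_T(P) = \sum_{\mathbf{x} \text{ of type } T} P(\mathbf{x}) \prod_{i = 0}^k \big(\psi_i(x_1)\psi_i(x_2) \cdots \psi_i(x_r)\big)^{e_i}.\] Then $\nu_p(\mathfrak{S}^{\mathbf{e}}_T(P)) \ge \lambda(T)$ for all words $T$ over $\mathcal{A}$. Moreover, there exists a finite automaton $\mathcal{F}$ over the alphabet $\mathcal{A}$ (depending only on $p$, $r$, $\mathbf{e}$ and $P$), reading its input from right to left, such that, for all words $T$ over $\mathcal{A}$, $\nu_p(\mathfrak{S}^{\mathbf{e}}_T(P)) = \lambda(T)$ if and only if $\mathcal{F}$ accepts $T$. -/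

import Mathlib

namespace AbacusSum

/-- The alphabet: its letters are the multisets of size `r` of digits in base `p`. -/
abbrev Letter (p r : ℕ) : Type := Sym (Fin p) r

/-- The letter labelling an abacus column, i.e. the multiset of the entries of the column. -/
def letterOf {p r : ℕ} (a : Fin r → Fin p) : Letter p r :=
  ⟨Multiset.map a Finset.univ.val, by simp⟩

/-- The digit of `x` in base `p` at the place of weight `p ^ m`. -/
def digit (p : ℕ) [Fact p.Prime] (m x : ℕ) : Fin p :=
  ⟨x / p ^ m % p, Nat.mod_lt _ (Fact.out : p.Prime).pos⟩

/-- The abacus with `n` columns of the vector `x`: row `i` holds the expansion of `x i` to base `p`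
from the most significant digit to the least significant one, padded with leading zeroes.
(All the components of `x` have to be below `p ^ n` for `n` columns to suffice.) -/
def abacus (p : ℕ) [Fact p.Prime] {r : ℕ} (n : ℕ) (x : Fin r → ℕ) : Matrix (Fin r) (Fin n) (Fin p) :=
  fun i j => digit p (n - 1 - j) (x i)

/-- The type of an abacus: the word of the labels of its columns, read from left to right. -/
def abacusType {p r n : ℕ} (A : Matrix (Fin r) (Fin n) (Fin p)) : List (Letter p r) :=
  List.ofFn fun j => letterOf fun i => A i j

/-- The finite set of all vectors of nonnegative integers whose abacus is of type `T`. -/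
def vectorsOfType (p : ℕ) [Fact p.Prime] {r : ℕ} (T : List (Letter p r)) : Finset (Fin r → ℕ) :=
  {x ∈ Fintype.piFinset fun _ : Fin r => Finset.range (p ^ T.length) |
    abacusType (abacus p T.length x) = T}

/-- `Θ_p(x)`, the part of `x` prime to `p`: `x = p ^ ν_p(x) * Θ_p(x)` for positive `x`. -/
def primeToPart (p x : ℕ) : ℕ := x / p ^ padicValNat p x

/-- `ψ_i(x) = Θ_p((p ^ i * x)!)`. -/
def psi (p i x : ℕ) : ℕ := primeToPart p (p ^ i * x).factorial

/-- The summand `F(x) = P(x) * ∏ i, (ψ_i(x_1) ⋯ ψ_i(x_r)) ^ e_i`. -/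
noncomputable def summand (p : ℕ) {r k : ℕ} (e : Fin (k + 1) → ℤ) (P : MvPolynomial (Fin r) ℤ)
    (x : Fin r → ℕ) : ℚ :=
  ((MvPolynomial.eval (fun j => (x j : ℤ)) P : ℤ) : ℚ) *
    ∏ i : Fin (k + 1), (∏ j : Fin r, (psi p i (x j) : ℚ)) ^ e i

/-- The sum of `F` over all vectors whose abacus is of type `T`. -/
noncomputable def abacusSum (p : ℕ) [Fact p.Prime] {r k : ℕ} (e : Fin (k + 1) → ℤ)
    (T : List (Letter p r)) (P : MvPolynomial (Fin r) ℤ) : ℚ :=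
  ∑ x ∈ vectorsOfType p T, summand p e P x

/-- `ϱ(I)`: the vectors whose components form a permutation of the multiset `I`. -/
def arrangements {p r : ℕ} (I : Letter p r) : Finset (Fin r → Fin p) :=
  {a | letterOf a = I}

/-- A letter is special when `p` divides the number of its arrangements. -/
def IsSpecial {p r : ℕ} (I : Letter p r) : Prop := p ∣ (arrangements I).card

instance {p r : ℕ} (I : Letter p r) : Decidable (IsSpecial I) :=
  inferInstanceAs (Decidable (p ∣ (arrangements I).card))

/-- `λ(T)`: the number of the special letters of the word `T`, counted with repetitions. -/
def specialCount {p r : ℕ} (T : List (Letter p r)) : ℕ :=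
  (T.map fun I => if IsSpecial I then 1 else 0).sum

/-- The exponent of `p` in a rational number; the exponent of `p` in `0` is infinite. -/
def exponent (p : ℕ) (q : ℚ) : WithTop ℤ :=
  if q = 0 then ⊤ else ((padicValRat p q : ℤ) : WithTop ℤ)

/-- The automaton `M`, going through its input from right to left, accepts the word `T`. -/
def AcceptsFromRight {α σ : Type} (M : DFA α σ) (T : List α) : Prop :=
  T.reverse ∈ M.accepts

end AbacusSum

namespace AbacusSum

open Finset

/-! ### Letters and their arrangements -/

section Letters

variable {p r : ℕ}

/-! Suppose first that the exponents `e` are nonnegative, and shift every index of ψ by n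
(`psiWeight`). Writing x = p y + a splits off the last column, and ψ_i(p y + a) is ψ_{i+1}(y) times
a polynomial in p y (`psi_mul_add`). Hence the sum over type T I with weight n and polynomial P is
the sum over type T with weight n + 1 and polynomial `transfer W I P`
(`IsWeightFamily.weightedSum_append`), which is again symmetric.

The new polynomial is evaluated at p X, so its degree d coefficients are divisible by p ^ d. By
symmetry all arrangements of I contribute equally to its constant term, which is thus divisible by p
when I is special. A special letter therefore yields a factor p, and what remains is modulo p of
degree at most one (`exists_transfer_eq`). Induction on T gives the lower bound
(`IsWeightFamily.pow_specialCount_dvd`).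

By this bound, whether equality holds depends on the polynomial only modulo p, so after one letter
finitely many polynomials matter. The shift n does not matter either once n ≥ 1: modulo p ^ 2 the
digit polynomials of ψ_i and ψ_{i+1} differ by units (`dvd_psiPoly_succ_sub`), which is precise
enough (`IsWeightFamily.exists_dvd_sub`). So the language of reversed sharp words has finitely many
left quotients, and Myhill–Nerode supplies the automaton.

For integer exponents, adding multiples of (p - 1) p ^ N changes the sum only modulo p ^ N. The N
needed grows with T, but the resulting natural exponents can be exchanged for fixed ones
(`exists_dvd_weightedSum_sub_of_congr`). -/

theorem mem_arrangements {I : Letter p r} {a : Fin r → Fin p} :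
    a ∈ arrangements I ↔ letterOf a = I := by
  simp [arrangements]

/-- Each digit has equally many positions in both vectors; bijections between these fibres glue to a
permutation. -/
theorem exists_perm_of_letterOf_eq {a b : Fin r → Fin p} (h : letterOf a = letterOf b) :
    ∃ τ : Equiv.Perm (Fin r), b ∘ τ = a := by
  have hm : Multiset.map a univ.val = Multiset.map b univ.val := congrArg Subtype.val h
  have hc (c : Fin p) : Nonempty ({j // a j = c} ≃ {j // b j = c}) := by
    refine ⟨Fintype.equivOfCardEq ?_⟩
    have := congrArg (Multiset.count c) hm
    rw [Multiset.count_map, Multiset.count_map] at this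
    rw [Fintype.card_subtype, Fintype.card_subtype]
    simpa only [Finset.card, Finset.filter_val, eq_comm] using this
  have f (c : Fin p) := (hc c).some
  exact ⟨Equiv.ofFiberEquiv f, funext fun j => Equiv.ofFiberEquiv_map f j⟩

theorem letterOf_comp_perm (a : Fin r → Fin p) (τ : Equiv.Perm (Fin r)) :
    letterOf (a ∘ τ) = letterOf a := by
  refine Subtype.ext ?_
  change Multiset.map (a ∘ τ) univ.val = Multiset.map a univ.val
  rw [← Multiset.map_map, Multiset.map_univ_val_equiv]

theorem specialCount_append_singleton (T : List (Letter p r)) (I : Letter p r) :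
    specialCount (T ++ [I]) = specialCount T + if IsSpecial I then 1 else 0 := by
  simp [specialCount]

theorem specialCount_reverse (T : List (Letter p r)) : specialCount T.reverse = specialCount T := by
  simp [specialCount, List.sum_reverse]

end Letters

/-! ### Splitting off the last column of an abacus -/

section Decomposition

variable {p : ℕ} [Fact p.Prime] {r : ℕ}

theorem digit_zero_mul_add (y : ℕ) (a : Fin p) : digit p 0 (p * y + a) = a := by
  ext
  simp [digit, Nat.mod_eq_of_lt a.2]

theorem mul_add_fin_div (y : ℕ) (a : Fin p) : (p * y + a) / p = y := by
  rw [Nat.mul_add_div (Fact.out : p.Prime).pos, Nat.div_eq_of_lt a.2, add_zero]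

theorem digit_succ_mul_add (m y : ℕ) (a : Fin p) : digit p (m + 1) (p * y + a) = digit p m y := by
  ext
  simp [digit, pow_succ', ← Nat.div_div_eq_div_mul, mul_add_fin_div]

theorem mem_vectorsOfType {T : List (Letter p r)} {x : Fin r → ℕ} :
    x ∈ vectorsOfType p T ↔
      (∀ j, x j < p ^ T.length) ∧ abacusType (abacus p T.length x) = T := by
  simp [vectorsOfType]

theorem abacusType_abacus_succ (n : ℕ) (y : Fin r → ℕ) (a : Fin r → Fin p) :
    abacusType (abacus p (n + 1) fun j => p * y j + a j) =
      abacusType (abacus p n y) ++ [letterOf a] := by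
  unfold abacusType abacus
  rw [List.ofFn_succ', List.concat_eq_append]
  congr 2
  · funext j
    congr 1
    funext i
    have : n + 1 - 1 - (j.castSucc : ℕ) = n - 1 - j + 1 := by
      have := j.2
      simp only [Fin.val_castSucc]
      omega
    rw [this, digit_succ_mul_add]
  · congr 1
    funext i
    simp [digit_zero_mul_add]

theorem vectorsOfType_nil : vectorsOfType p ([] : List (Letter p r)) = {0} := by
  ext x
  simp [mem_vectorsOfType, abacusType, funext_iff]

theorem mul_add_mem_vectorsOfType {T : List (Letter p r)} {I : Letter p r} {y : Fin r → ℕ}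
    {a : Fin r → Fin p} :
    (fun j => p * y j + a j) ∈ vectorsOfType p (T ++ [I]) ↔
      y ∈ vectorsOfType p T ∧ a ∈ arrangements I := by
  have h : ∀ j, p * y j + a j < p ^ (T.length + 1) ↔ y j < p ^ T.length := fun j => by
    rw [pow_succ, ← Nat.div_lt_iff_lt_mul (Fact.out : p.Prime).pos, mul_add_fin_div]
  rw [mem_vectorsOfType, mem_vectorsOfType, mem_arrangements, List.length_append,
    List.length_singleton, abacusType_abacus_succ]
  simp only [h, and_assoc]
  refine and_congr_right fun _ => ⟨fun H => ?_, fun ⟨H₁, H₂⟩ => congrArg₂ _ H₁ (by rw [H₂])⟩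
  simpa using List.append_inj' H rfl

/-- Splitting off the least significant digits of the vectors of a given type. -/
theorem sum_vectorsOfType_append {M : Type*} [AddCommMonoid M] (T : List (Letter p r))
    (I : Letter p r) (F : (Fin r → ℕ) → M) :
    ∑ x ∈ vectorsOfType p (T ++ [I]), F x =
      ∑ y ∈ vectorsOfType p T, ∑ a ∈ arrangements I, F fun j => p * y j + a j := by
  have key : ∀ x : Fin r → ℕ, (fun j => p * (x j / p) + (digit p 0 (x j) : ℕ)) = x := fun x => by
    funext j
    simp [digit, Nat.div_add_mod]
  rw [← sum_product']
  refine sum_bij' (fun x _ => (fun j => x j / p, fun j => digit p 0 (x j)))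
    (fun z _ j => p * z.1 j + z.2 j) (fun x hx => ?_) (fun z hz => ?_) (fun x _ => key x)
    (fun z _ => ?_) (fun x _ => by rw [key x])
  · rw [mem_product, ← mul_add_mem_vectorsOfType (p := p), key]
    exact hx
  · exact mul_add_mem_vectorsOfType.2 (mem_product.1 hz)
  · ext j
    · simp only [mul_add_fin_div]
    · simp only [digit_zero_mul_add]

end Decomposition

/-! ### The recursion for ψ under appending a digit -/

section Psi

variable {p : ℕ}

theorem primeToPart_eq_ordCompl [hp : Fact p.Prime] (x : ℕ) :
    primeToPart p x = x / p ^ x.factorization p := by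
  rw [primeToPart, Nat.factorization_def _ hp.out]

theorem primeToPart_mul [Fact p.Prime] (x y : ℕ) :
    primeToPart p (x * y) = primeToPart p x * primeToPart p y := by
  simp only [primeToPart_eq_ordCompl, Nat.ordCompl_mul]

theorem primeToPart_of_not_dvd {x : ℕ} (h : ¬ p ∣ x) : primeToPart p x = x := by
  rw [primeToPart, padicValNat.eq_zero_of_not_dvd h, pow_zero, Nat.div_one]

theorem primeToPart_prime_mul [hp : Fact p.Prime] (x : ℕ) :
    primeToPart p (p * x) = primeToPart p x := by
  rw [primeToPart_mul, primeToPart, padicValNat_self, pow_one, Nat.div_self hp.out.pos, one_mul]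

theorem not_dvd_primeToPart [hp : Fact p.Prime] {x : ℕ} (h : x ≠ 0) : ¬ p ∣ primeToPart p x := by
  rw [primeToPart_eq_ordCompl]
  exact Nat.not_dvd_ordCompl hp.out h

theorem padicValNat_le_of_lt_pow {t i : ℕ} (h0 : t ≠ 0) (h : t < p ^ (i + 1)) :
    padicValNat p t ≤ i := by
  by_contra! hi
  exact absurd (Nat.le_of_dvd (Nat.pos_of_ne_zero h0)
    ((pow_dvd_pow p hi).trans pow_padicValNat_dvd)) (not_le.2 h)

/-- The bound on t forces ν_p(t) ≤ i, so p ^ ν_p(t) factors out of the sum, and the cofactor is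
congruent to Θ_p(t) modulo p, hence prime to p. -/
theorem primeToPart_pow_mul_add [hp : Fact p.Prime] {t i : ℕ} (y : ℕ) (h0 : t ≠ 0)
    (h : t < p ^ (i + 1)) :
    primeToPart p (p ^ (i + 1) * y + t) =
      primeToPart p t + p ^ (i - padicValNat p t) * (p * y) := by
  have hv := padicValNat_le_of_lt_pow h0 h
  set v := padicValNat p t with hvdef
  have ht : t = p ^ v * primeToPart p t := (Nat.mul_div_cancel' pow_padicValNat_dvd).symm
  have hs := not_dvd_primeToPart (p := p) h0
  have hpow : primeToPart p (p ^ v) = 1 := by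
    rw [primeToPart, padicValNat.prime_pow, Nat.div_self (pow_pos hp.out.pos _)]
  have : p ^ (i + 1) * y + t = p ^ v * (primeToPart p t + p ^ (i - v) * (p * y)) := by
    conv_lhs => rw [ht]
    have : p ^ (i + 1) = p ^ v * p ^ (i - v) * p := by
      rw [← pow_add, ← pow_succ]; congr 1; omega
    rw [this]; ring
  rw [this, primeToPart_mul, hpow, one_mul, primeToPart_of_not_dvd]
  rw [← mul_assoc, mul_right_comm]
  exact fun H => hs ((Nat.dvd_add_left (Dvd.intro_left _ rfl)).1 H)

theorem primeToPart_factorial_add [hp : Fact p.Prime] (i y m : ℕ) (hm : m < p ^ (i + 1)) :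
    primeToPart p (p ^ (i + 1) * y + m).factorial = psi p (i + 1) y *
      ∏ t ∈ Icc 1 m, (primeToPart p t + p ^ (i - padicValNat p t) * (p * y)) := by
  induction m with
  | zero => simp [psi]
  | succ m ih =>
    rw [← add_assoc, Nat.factorial_succ, primeToPart_mul, ih (by omega), add_assoc,
      primeToPart_pow_mul_add y (Nat.succ_ne_zero m) hm, prod_Icc_succ_top (Nat.le_add_left 1 m)]
    ring

theorem psi_mul_add [hp : Fact p.Prime] (i y : ℕ) (a : Fin p) :
    psi p i (p * y + a) = psi p (i + 1) y *
      ∏ t ∈ Icc 1 (p ^ i * a), (primeToPart p t + p ^ (i - padicValNat p t) * (p * y)) := by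
  have : p ^ i * (p * y + a) = p ^ (i + 1) * y + p ^ i * a := by ring
  rw [psi, this, primeToPart_factorial_add]
  rw [pow_succ]
  exact Nat.mul_lt_mul_of_pos_left a.2 (pow_pos hp.out.pos _)

theorem psi_zero_right (i : ℕ) : psi p i 0 = 1 := by
  simp [psi, primeToPart]

theorem not_dvd_psi [hp : Fact p.Prime] (i x : ℕ) : ¬ p ∣ psi p i x :=
  not_dvd_primeToPart (Nat.factorial_ne_zero _)

end Psi

end AbacusSum

namespace AbacusSum

open Finset

/-! ### The polynomial transfer caused by removing a letter -/

section Transfer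

open MvPolynomial

variable {p r : ℕ}

/-- The substitution `X ↦ p X`. -/
noncomputable def scale (p : ℕ) : MvPolynomial (Fin r) ℤ →ₐ[ℤ] MvPolynomial (Fin r) ℤ :=
  aeval fun j => C (p : ℤ) * X j

theorem eval_scale (f : MvPolynomial (Fin r) ℤ) (y : Fin r → ℤ) :
    eval y (scale p f) = eval (fun j => p * y j) f := by
  rw [scale, ← MvPolynomial.coe_aeval_eq_eval, ← MvPolynomial.coe_aeval_eq_eval]
  change ((aeval y).comp (aeval fun j => C (p : ℤ) * X j)) f = _
  rw [comp_aeval]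
  simp

theorem coeff_scale (f : MvPolynomial (Fin r) ℤ) (m : Fin r →₀ ℕ) :
    coeff m (scale p f) = p ^ m.degree * coeff m f := by
  induction f using MvPolynomial.induction_on' with
  | monomial u c =>
    have : scale p (monomial u c) = monomial u (p ^ u.degree * c) := by
      rw [scale, aeval_monomial, monomial_eq (s := u), algebraMap_eq, C_mul, C_pow]
      simp only [mul_pow, Finsupp.prod_mul]
      have : (u.prod fun _ k => (C (p : ℤ) : MvPolynomial (Fin r) ℤ) ^ k) =
          C (p : ℤ) ^ u.degree := by
        rw [Finsupp.prod, prod_pow_eq_pow_sum, Finsupp.degree_apply]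
      rw [this]
      ring
    rw [this, coeff_monomial, coeff_monomial]
    split_ifs with h
    · rw [h]
    · simp
  | add f g hf hg => rw [map_add, coeff_add, coeff_add, hf, hg, mul_add]

theorem rename_scale (τ : Equiv.Perm (Fin r)) (f : MvPolynomial (Fin r) ℤ) :
    rename τ (scale p f) = scale p (rename τ f) := by
  rw [scale, aeval_rename]
  change ((rename τ).comp (aeval fun j => C (p : ℤ) * X j)) f = _
  rw [comp_aeval]
  congr 2
  funext j
  simp

/-- The sum over all digit columns with label `I`, before the substitution `X ↦ p X`. -/
noncomputable def preTransfer (W : ℕ → Polynomial ℤ) (I : Letter p r)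
    (P : MvPolynomial (Fin r) ℤ) : MvPolynomial (Fin r) ℤ :=
  ∑ a ∈ arrangements I, aeval (fun j => X j + C ((a j : ℕ) : ℤ)) P *
    ∏ j, Polynomial.aeval (X j) (W (a j))

/-- The polynomial which takes over the role of `P` when a final letter `I` is removed. -/
noncomputable def transfer (W : ℕ → Polynomial ℤ) (I : Letter p r)
    (P : MvPolynomial (Fin r) ℤ) : MvPolynomial (Fin r) ℤ :=
  scale p (preTransfer W I P)

theorem preTransfer_isSymmetric (W : ℕ → Polynomial ℤ) (I : Letter p r)
    {P : MvPolynomial (Fin r) ℤ} (hP : P.IsSymmetric) : (preTransfer W I P).IsSymmetric := by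
  intro τ
  rw [preTransfer, map_sum]
  refine sum_equiv (Equiv.arrowCongr τ (Equiv.refl _)) (fun a => ?_) fun a _ => ?_
  · rw [mem_arrangements, mem_arrangements]
    change _ ↔ letterOf (a ∘ τ.symm) = I
    rw [letterOf_comp_perm]
  · rw [map_mul, map_prod]
    congr 1
    · conv_rhs => rw [← hP τ, aeval_rename]
      change ((rename τ).comp (aeval fun j => X j + C ((a j : ℕ) : ℤ))) P = _
      rw [comp_aeval]
      congr 2
      funext j
      simp [Equiv.arrowCongr]
    · conv_rhs => rw [← Equiv.prod_comp τ]
      refine prod_congr rfl fun j _ => ?_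
      rw [← Polynomial.aeval_algHom_apply]
      simp [Equiv.arrowCongr]

theorem transfer_isSymmetric (W : ℕ → Polynomial ℤ) (I : Letter p r)
    {P : MvPolynomial (Fin r) ℤ} (hP : P.IsSymmetric) : (transfer W I P).IsSymmetric := fun τ => by
  rw [transfer, rename_scale, preTransfer_isSymmetric W I hP τ]

theorem constantCoeff_aeval_add (P : MvPolynomial (Fin r) ℤ) (c : Fin r → ℤ) :
    constantCoeff (aeval (fun j => X j + C (c j)) P) = eval c P := by
  rw [← MvPolynomial.coe_aeval_eq_eval]
  change ((constantCoeff (R := ℤ) (σ := Fin r)).toIntAlgHom.comp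
    (aeval fun j => X j + C (c j))) P = _
  rw [comp_aeval]
  simp

theorem constantCoeff_aeval_X (Q : Polynomial ℤ) (j : Fin r) :
    constantCoeff (Polynomial.aeval (X j : MvPolynomial (Fin r) ℤ) Q) = Q.eval 0 := by
  change ((constantCoeff (R := ℤ) (σ := Fin r)).toIntAlgHom.comp (Polynomial.aeval (X j))) Q = _
  rw [← Polynomial.aeval_algHom]
  simp [Polynomial.aeval_def, Polynomial.eval₂_eq_eval_map]

/-- Arrangements of I are permutations of one another and P is symmetric, so all summands have the
same constant term, taken |ϱ(I)| times. -/
theorem dvd_constantCoeff_preTransfer (W : ℕ → Polynomial ℤ) {I : Letter p r}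
    {P : MvPolynomial (Fin r) ℤ} (hP : P.IsSymmetric) (hI : IsSpecial I) :
    (p : ℤ) ∣ constantCoeff (preTransfer W I P) := by
  have hsum : constantCoeff (preTransfer W I P) = ∑ a ∈ arrangements I,
      eval (fun j => ((a j : ℕ) : ℤ)) P * ∏ j, (W (a j)).eval 0 := by
    rw [preTransfer, map_sum]
    refine sum_congr rfl fun a _ => ?_
    rw [map_mul, map_prod, constantCoeff_aeval_add]
    simp only [constantCoeff_aeval_X]
  rw [hsum]
  obtain h | ⟨b, hb⟩ := (arrangements I).eq_empty_or_nonempty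
  · simp [h]
  rw [sum_congr rfl (g := fun _ => eval (fun j => ((b j : ℕ) : ℤ)) P * ∏ j, (W (b j)).eval 0),
    sum_const, nsmul_eq_mul]
  · exact Dvd.dvd.mul_right (Int.natCast_dvd_natCast.2 hI) _
  · intro a ha
    obtain ⟨τ, rfl⟩ := exists_perm_of_letterOf_eq
      ((mem_arrangements.1 ha).trans (mem_arrangements.1 hb).symm)
    congr 1
    · conv_rhs => rw [← hP τ, eval_rename]
      rfl
    · exact Equiv.prod_comp τ fun j => (W (b j)).eval 0

/-- The substitution X ↦ p X supplies a factor p in positive degree; speciality of I supplies it in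
degree zero. -/
theorem dvd_transfer (W : ℕ → Polynomial ℤ) {I : Letter p r}
    {P : MvPolynomial (Fin r) ℤ} (hP : P.IsSymmetric) (hI : IsSpecial I) :
    C (p : ℤ) ∣ transfer W I P := by
  rw [C_dvd_iff_dvd_coeff]
  intro m
  rw [transfer, coeff_scale]
  obtain rfl | hm := eq_or_ne m 0
  · exact Dvd.dvd.mul_left (dvd_constantCoeff_preTransfer W hP hI) _
  · exact Dvd.dvd.mul_right (dvd_pow_self _ (by rwa [Ne, Finsupp.degree_eq_zero_iff])) _

theorem isSymmetric_of_C_mul {c : ℤ} (hc : c ≠ 0) {Q : MvPolynomial (Fin r) ℤ}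
    (h : (C c * Q).IsSymmetric) : Q.IsSymmetric := fun τ => by
  have := h τ
  rw [map_mul, rename_C] at this
  exact mul_left_cancel₀ (C_ne_zero.2 hc) this

/-- The transferred polynomial is divisible by `p` when the removed letter is special, and the
quotient is congruent to a polynomial of degree at most one. -/
theorem exists_transfer_eq (hp : (p : ℤ) ≠ 0) (W : ℕ → Polynomial ℤ) (I : Letter p r)
    {P : MvPolynomial (Fin r) ℤ} (hP : P.IsSymmetric) :
    ∃ Q : MvPolynomial (Fin r) ℤ, Q.IsSymmetric ∧ (∀ m, 2 ≤ m.degree → (p : ℤ) ∣ coeff m Q) ∧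
      transfer W I P = C ((p : ℤ) ^ if IsSpecial I then 1 else 0) * Q := by
  have hT := transfer_isSymmetric W I hP
  have hc (m : Fin r →₀ ℕ) (hm : 2 ≤ m.degree) : (p : ℤ) ^ 2 ∣ coeff m (transfer W I P) := by
    rw [transfer, coeff_scale]
    exact Dvd.dvd.mul_right (pow_dvd_pow _ hm) _
  split_ifs with hI
  · rw [pow_one]
    obtain ⟨Q, hQ⟩ := dvd_transfer W hP hI
    refine ⟨Q, isSymmetric_of_C_mul hp (hQ ▸ hT), fun m hm => ?_, hQ⟩
    have := hc m hm
    rwa [hQ, coeff_C_mul, sq, mul_dvd_mul_iff_left hp] at this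
  · exact ⟨_, hT, fun m hm => (dvd_pow_self _ two_ne_zero).trans (hc m hm), by simp⟩

theorem aeval_X_comp_scale (Q : Polynomial ℤ) (j : Fin r) :
    scale p (Polynomial.aeval (X j) Q) =
      Polynomial.aeval (X j) (Q.comp (Polynomial.C (p : ℤ) * Polynomial.X)) := by
  rw [Polynomial.aeval_comp, ← Polynomial.aeval_algHom_apply]
  simp [scale]

theorem dvd_prod_sub_prod {R ι : Type*} [CommRing R] (s : Finset ι) {d : R} {f g : ι → R}
    (h : ∀ i ∈ s, d ∣ f i - g i) : d ∣ ∏ i ∈ s, f i - ∏ i ∈ s, g i := by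
  rw [← Ideal.mem_span_singleton, ← Ideal.Quotient.mk_eq_mk_iff_sub_mem, map_prod, map_prod]
  exact prod_congr rfl fun i hi => by
    rw [Ideal.Quotient.mk_eq_mk_iff_sub_mem, Ideal.mem_span_singleton]
    exact h i hi

theorem sum_eq_of_mem_arrangements {I : Letter p r} {a : Fin r → Fin p} (ha : a ∈ arrangements I) :
    ∑ j, (a j : ℕ) = (I.1.map Fin.val).sum := by
  rw [← mem_arrangements.1 ha]
  simp only [letterOf, Multiset.map_map]
  rfl

/-- The factors ε ^ a_j multiply to ε raised to the digit sum, which is the same for all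
arrangements of I and so leaves the sum. -/
theorem dvd_transfer_sub (d ε : ℤ) {W W' : ℕ → Polynomial ℤ}
    (h : ∀ a : Fin p, Polynomial.C d ∣ (W' a).comp (Polynomial.C (p : ℤ) * Polynomial.X) -
      Polynomial.C (ε ^ (a : ℕ)) * (W a).comp (Polynomial.C (p : ℤ) * Polynomial.X))
    (I : Letter p r) (P : MvPolynomial (Fin r) ℤ) :
    C d ∣ transfer W' I P - C (ε ^ (I.1.map Fin.val).sum) * transfer W I P := by
  simp only [transfer, preTransfer, map_sum, map_mul (scale p), map_prod, mul_sum,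
    ← sum_sub_distrib]
  refine dvd_sum fun a ha => ?_
  rw [mul_left_comm, ← mul_sub, ← sum_eq_of_mem_arrangements ha, ← prod_pow_eq_pow_sum, map_prod,
    ← prod_mul_distrib]
  refine Dvd.dvd.mul_left (dvd_prod_sub_prod _ fun j _ => ?_) _
  have := map_dvd (Polynomial.aeval (X j : MvPolynomial (Fin r) ℤ)) (h (a j))
  simpa only [map_sub, map_mul, Polynomial.aeval_C, algebraMap_eq, aeval_X_comp_scale] using this

end Transfer

/-! ### Weighted sums: the lower bound and comparison of weights -/

section WeightedSum

open MvPolynomial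

variable {p : ℕ} [Fact p.Prime] {r : ℕ}

/-- The sum of `P(x) g(x_1) ⋯ g(x_r)` over all vectors of type `T`. -/
noncomputable def weightedSum (g : ℕ → ℤ) (T : List (Letter p r)) (P : MvPolynomial (Fin r) ℤ) :
    ℤ :=
  ∑ x ∈ vectorsOfType p T, eval (fun j => (x j : ℤ)) P * ∏ j, g (x j)

/-- A sequence of weight functions such that splitting off the least significant digit `a` from the
argument of `g n` yields the next weight function times the value of a polynomial `W n a`. -/
structure IsWeightFamily (p : ℕ) (g : ℕ → ℕ → ℤ) (W : ℕ → ℕ → Polynomial ℤ) : Prop where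
  map_zero : ∀ n, g n 0 = 1
  map_mul_add : ∀ n (y : ℕ) (a : Fin p), g n (p * y + a) = g (n + 1) y * (W n a).eval ((p * y : ℤ))

theorem weightedSum_add (g : ℕ → ℤ) (T : List (Letter p r)) (P Q : MvPolynomial (Fin r) ℤ) :
    weightedSum g T (P + Q) = weightedSum g T P + weightedSum g T Q := by
  simp only [weightedSum, map_add, add_mul, sum_add_distrib]

theorem weightedSum_C_mul (g : ℕ → ℤ) (T : List (Letter p r)) (c : ℤ)
    (P : MvPolynomial (Fin r) ℤ) : weightedSum g T (C c * P) = c * weightedSum g T P := by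
  simp only [weightedSum, map_mul, eval_C, mul_assoc, mul_sum]

theorem weightedSum_nil {g : ℕ → ℤ} (hg : g 0 = 1) (P : MvPolynomial (Fin r) ℤ) :
    weightedSum g ([] : List (Letter p r)) P = constantCoeff P := by
  rw [weightedSum, vectorsOfType_nil, sum_singleton]
  simp [hg, constantCoeff_eq, eval_zero']

namespace IsWeightFamily

variable {g g' : ℕ → ℕ → ℤ} {W W' : ℕ → ℕ → Polynomial ℤ}

theorem weightedSum_append (hg : IsWeightFamily p g W) (n : ℕ) (T : List (Letter p r))
    (I : Letter p r) (P : MvPolynomial (Fin r) ℤ) :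
    weightedSum (g n) (T ++ [I]) P = weightedSum (g (n + 1)) T (transfer (W n) I P) := by
  rw [weightedSum, sum_vectorsOfType_append, weightedSum]
  refine sum_congr rfl fun y _ => ?_
  rw [transfer, eval_scale, preTransfer, map_sum, sum_mul]
  refine sum_congr rfl fun a _ => ?_
  rw [map_mul, map_prod, mul_assoc]
  congr 1
  · rw [← MvPolynomial.coe_aeval_eq_eval, ← MvPolynomial.coe_aeval_eq_eval]
    change _ = ((aeval fun j => (p * y j : ℤ)).comp (aeval fun j => X j + C ((a j : ℕ) : ℤ))) P
    rw [comp_aeval]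
    simp
  · rw [← prod_mul_distrib]
    refine prod_congr rfl fun j _ => ?_
    rw [hg.map_mul_add, mul_comm, ← MvPolynomial.coe_aeval_eq_eval]
    congr 1
    change _ = (aeval fun j => (p * y j : ℤ)) ((Polynomial.aeval (X j)) (W n (a j)))
    rw [← Polynomial.aeval_algHom_apply]
    simp

theorem pow_specialCount_dvd (hg : IsWeightFamily p g W) (T : List (Letter p r)) :
    ∀ (n : ℕ) {P : MvPolynomial (Fin r) ℤ}, P.IsSymmetric →
      (p : ℤ) ^ specialCount T ∣ weightedSum (g n) T P := by
  have hp : (p : ℤ) ≠ 0 := by exact_mod_cast (Fact.out : p.Prime).ne_zero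
  induction T using List.reverseRecOn with
  | nil => exact fun n P _ => by simp [specialCount]
  | append_singleton T I ih =>
    intro n P hP
    rw [specialCount_append_singleton, hg.weightedSum_append]
    obtain ⟨Q, hQ, -, h⟩ := exists_transfer_eq hp (W n) I hP
    rw [h, weightedSum_C_mul, add_comm, pow_add]
    exact mul_dvd_mul_left _ (ih _ hQ)

/-- Two families of weights whose digit polynomials agree up to units modulo `p ^ 2` have the same
weighted sums, up to units and to the first order that matters. -/
theorem exists_dvd_sub (hg : IsWeightFamily p g W) (hg' : IsWeightFamily p g' W') (n₀ : ℕ)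
    (ε : ℕ → ℤ) (hε : ∀ n, IsCoprime (ε n) p)
    (h : ∀ n, n₀ ≤ n → ∀ a : Fin p, Polynomial.C ((p : ℤ) ^ 2) ∣
      (W' n a).comp (Polynomial.C (p : ℤ) * Polynomial.X) -
      Polynomial.C (ε n ^ (a : ℕ)) * (W n a).comp (Polynomial.C (p : ℤ) * Polynomial.X))
    (T : List (Letter p r)) :
    ∀ n, n₀ ≤ n → ∃ u : ℤ, IsCoprime u p ∧ ∀ P : MvPolynomial (Fin r) ℤ, P.IsSymmetric →
      (p : ℤ) ^ (specialCount T + 1) ∣ weightedSum (g' n) T P - u * weightedSum (g n) T P := by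
  have hp : (p : ℤ) ≠ 0 := by exact_mod_cast (Fact.out : p.Prime).ne_zero
  induction T using List.reverseRecOn with
  | nil =>
    refine fun n _ => ⟨1, isCoprime_one_left, fun P _ => ?_⟩
    rw [weightedSum_nil (hg.map_zero n), weightedSum_nil (hg'.map_zero n), one_mul, sub_self]
    exact dvd_zero _
  | append_singleton T I ih =>
    intro n hn
    obtain ⟨u, hu, ihu⟩ := ih (n + 1) (by omega)
    set s := (I.1.map Fin.val).sum with hs
    refine ⟨ε n ^ s * u, ((hε n).pow_left).mul_left hu, fun P hP => ?_⟩
    rw [hg.weightedSum_append, hg'.weightedSum_append, specialCount_append_singleton]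
    have hW := transfer_isSymmetric (W n) I hP
    obtain ⟨D, hD⟩ := dvd_transfer_sub _ _ (h n hn) I P
    rw [← hs] at hD
    have hDs : D.IsSymmetric := by
      refine isSymmetric_of_C_mul (pow_ne_zero 2 hp) fun τ => ?_
      rw [← hD, map_sub, map_mul, rename_C, hW τ, transfer_isSymmetric (W' n) I hP τ]
    have hsplit : weightedSum (g' (n + 1)) T (transfer (W' n) I P) =
        ε n ^ s * weightedSum (g' (n + 1)) T (transfer (W n) I P) +
          p ^ 2 * weightedSum (g' (n + 1)) T D := by
      rw [← weightedSum_C_mul, ← weightedSum_C_mul, ← weightedSum_add, ← hD]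
      congr 1
      ring
    have hcomb : weightedSum (g' (n + 1)) T (transfer (W' n) I P) -
        ε n ^ s * u * weightedSum (g (n + 1)) T (transfer (W n) I P) =
        ε n ^ s * (weightedSum (g' (n + 1)) T (transfer (W n) I P) -
          u * weightedSum (g (n + 1)) T (transfer (W n) I P)) +
          p ^ 2 * weightedSum (g' (n + 1)) T D := by
      rw [hsplit]; ring
    rw [hcomb]
    refine dvd_add (Dvd.dvd.mul_left ?_ _) ?_
    · obtain ⟨Q, hQ, -, hQe⟩ := exists_transfer_eq hp (W n) I hP
      rw [hQe, weightedSum_C_mul, weightedSum_C_mul, mul_left_comm, ← mul_sub, add_right_comm,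
        add_comm, pow_add]
      exact mul_dvd_mul_left _ (ihu Q hQ)
    -- The letter I raises the special count by at most one, so the error p ^ 2 D, whose sum has
    -- another p ^ λ(T) by the lower bound, is negligible.
    · refine (pow_dvd_pow (p : ℤ) (n := specialCount T + 2) (by split_ifs <;> omega)).trans ?_
      rw [add_comm, pow_add]
      exact mul_dvd_mul_left _ (hg'.pow_specialCount_dvd T _ hDs)

end IsWeightFamily

end WeightedSum

end AbacusSum

namespace AbacusSum

open Finset

/-! ### Digit polynomials of ψ modulo p ^ 2 -/

section PsiWeight

open Polynomial

variable {p : ℕ}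

/-- The polynomial which describes how `ψ_i` changes when a least significant digit `a` is
appended to its argument. -/
noncomputable def psiPoly (p i a : ℕ) : ℤ[X] :=
  ∏ t ∈ Icc 1 (p ^ i * a), (C (primeToPart p t : ℤ) + C ((p : ℤ) ^ (i - padicValNat p t)) * X)

theorem psiPoly_comp (i a : ℕ) : (psiPoly p i a).comp (C (p : ℤ) * X) =
    ∏ t ∈ Icc 1 (p ^ i * a),
      (C (primeToPart p t : ℤ) + C ((p : ℤ) ^ (i - padicValNat p t)) * (C (p : ℤ) * X)) := by
  simp [psiPoly, Polynomial.prod_comp]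

theorem prod_Icc_one_add {M : Type*} [CommMonoid M] (f : ℕ → M) (m n : ℕ) :
    ∏ t ∈ Icc 1 (m + n), f t = (∏ t ∈ Icc 1 m, f t) * ∏ t ∈ Icc 1 n, f (m + t) := by
  induction n with
  | zero => simp
  | succ n ih =>
    rw [← add_assoc, prod_Icc_succ_top (by omega), ih, prod_Icc_succ_top (by omega), mul_assoc,
      add_assoc]

/-- The product of the positive integers up to `m` that are prime to `p`. -/
def unitProd (p m : ℕ) : ℤ := ∏ t ∈ Icc 1 m with ¬ p ∣ t, (t : ℤ)

/-- The range is cut into a blocks of length q, each congruent to the first; p ∣ q makes the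
coprimality condition periodic. -/
theorem unitProd_mul_modEq {q : ℕ} (hq : p ∣ q) (a : ℕ) :
    unitProd p (q * a) ≡ unitProd p q ^ a [ZMOD q] := by
  induction a with
  | zero => simp [unitProd]
  | succ a ih =>
    have hsplit : unitProd p (q * (a + 1)) = unitProd p (q * a) *
        ∏ t ∈ Icc 1 q with ¬ p ∣ t, ((q * a + t : ℕ) : ℤ) := by
      simp only [unitProd, prod_filter]
      rw [mul_add_one, prod_Icc_one_add]
      simp only [Nat.dvd_add_right (hq.mul_right a)]
    rw [hsplit, pow_succ]
    refine ih.mul (Int.ModEq.prod fun t _ => ?_)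
    rw [Int.modEq_iff_dvd]
    exact ⟨-a, by push_cast; ring⟩

theorem IsWeightFamily.succ {g : ℕ → ℕ → ℤ} {W : ℕ → ℕ → ℤ[X]} (h : IsWeightFamily p g W) :
    IsWeightFamily p (fun n => g (n + 1)) fun n => W (n + 1) where
  map_zero n := h.map_zero (n + 1)
  map_mul_add n := h.map_mul_add (n + 1)

variable [Fact p.Prime]

theorem psi_mul_add_eq_eval (i y : ℕ) (a : Fin p) :
    (psi p i (p * y + a) : ℤ) = psi p (i + 1) y * (psiPoly p i a).eval ((p * y : ℤ)) := by
  rw [psi_mul_add, psiPoly, eval_prod]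
  push_cast
  simp

theorem isCoprime_unitProd (m : ℕ) : IsCoprime (unitProd p m) p := by
  refine IsCoprime.prod_left fun t ht => ?_
  rw [Nat.isCoprime_iff_coprime, Nat.coprime_comm, (Fact.out : p.Prime).coprime_iff_not_dvd]
  exact (mem_filter.1 ht).2

/-- For t = p s, both i + 1 and ν_p drop by one on passing to s, while Θ_p is unchanged. -/
theorem prod_dvd_psiPoly_comp (i a : ℕ) :
    ∏ t ∈ Icc 1 (p ^ (i + 1) * a) with p ∣ t, (C (primeToPart p t : ℤ) +
      C ((p : ℤ) ^ (i + 1 - padicValNat p t)) * (C (p : ℤ) * X)) =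
    (psiPoly p i a).comp (C (p : ℤ) * X) := by
  have hp := (Fact.out : p.Prime)
  rw [psiPoly_comp]
  symm
  refine prod_nbij (p * ·) (fun t ht => ?_) (fun s _ t _ h => Nat.eq_of_mul_eq_mul_left hp.pos h)
    (fun t ht => ?_) fun t ht => ?_
  · rw [mem_Icc] at ht
    rw [mem_filter, mem_Icc, pow_succ', mul_assoc]
    exact ⟨⟨Nat.mul_pos hp.pos ht.1, Nat.mul_le_mul_left _ ht.2⟩, dvd_mul_right _ _⟩
  · simp only [coe_filter, Set.mem_ofPred_eq, mem_Icc] at ht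
    obtain ⟨⟨h1, h2⟩, s, rfl⟩ := ht
    refine ⟨s, ?_, rfl⟩
    rw [pow_succ', mul_assoc] at h2
    exact mem_coe.2 (mem_Icc.2 ⟨Nat.pos_of_mul_pos_left h1, Nat.le_of_mul_le_mul_left h2 hp.pos⟩)
  · rw [mem_Icc] at ht
    rw [primeToPart_prime_mul, padicValNat.mul hp.ne_zero (by omega), padicValNat_self, add_comm 1,
      Nat.add_sub_add_right]

/-- Modulo `p ^ 2`, passing from `ψ_i` to `ψ_{i + 1}` changes the digit polynomials by units. -/
theorem dvd_psiPoly_succ_sub {i : ℕ} (hi : 1 ≤ i) (a : ℕ) :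
    C ((p : ℤ) ^ 2) ∣ (psiPoly p (i + 1) a).comp (C (p : ℤ) * X) -
      C (unitProd p (p ^ (i + 1)) ^ a) * (psiPoly p i a).comp (C (p : ℤ) * X) := by
  -- Multiples of p reproduce the polynomial for i. The other factors are constants modulo p ^ (i +
  -- 1), and i ≥ 1 makes this fine enough for p ^ 2.
  rw [psiPoly_comp (i + 1), ← prod_filter_mul_prod_filter_not _ (p ∣ ·), prod_dvd_psiPoly_comp,
    mul_comm, ← sub_mul]
  refine Dvd.dvd.mul_right ?_ _
  rw [← sub_add_sub_cancel _ (C (unitProd p (p ^ (i + 1) * a)))]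
  refine dvd_add ?_ ?_
  · rw [unitProd, map_prod]
    refine dvd_prod_sub_prod _ fun t ht => ?_
    have ht := (mem_filter.1 ht).2
    rw [primeToPart_of_not_dvd ht, add_sub_cancel_left, padicValNat.eq_zero_of_not_dvd ht]
    exact (_root_.map_dvd C (pow_dvd_pow _ (by omega))).mul_right _
  · rw [← map_sub]
    refine _root_.map_dvd C ((pow_dvd_pow (p : ℤ) (by omega : 2 ≤ i + 1)).trans ?_)
    have := unitProd_mul_modEq (dvd_pow_self p (Nat.succ_ne_zero i)) a
    exact_mod_cast this.symm.dvd

theorem dvd_pow_sub_one {c : ℤ} (hc : ¬ (p : ℤ) ∣ c) : (p : ℤ) ∣ c ^ (p - 1) - 1 := by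
  have hp := (Fact.out : p.Prime)
  refine (Int.ModEq.pow_card_sub_one_eq_one hp ?_).symm.dvd
  exact ((Nat.prime_iff_prime_int.1 hp).coprime_iff_not_dvd.2 hc).symm

/-- Modulo p the polynomial is a constant prime to p, so Fermat makes its (p - 1)-th power 1; a
further p-th power lifts this to modulo p ^ 2. -/
theorem dvd_psiPoly_pow_sub_one (i a m : ℕ) :
    C ((p : ℤ) ^ 2) ∣ (psiPoly p i a).comp (C (p : ℤ) * X) ^ (p * (p - 1) * m) - 1 := by
  have hp := Nat.prime_iff_prime_int.1 (Fact.out : p.Prime)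
  set A := (psiPoly p i a).comp (C (p : ℤ) * X) with hA
  set c : ℤ := ∏ t ∈ Icc 1 (p ^ i * a), (primeToPart p t : ℤ) with hc
  have h1 : C (p : ℤ) ∣ A - C c := by
    rw [hA, hc, psiPoly_comp, map_prod]
    refine dvd_prod_sub_prod _ fun t _ => ?_
    rw [add_sub_cancel_left, mul_left_comm]
    exact dvd_mul_right _ _
  have h2 : C (p : ℤ) ∣ A ^ (p - 1) - 1 := by
    rw [← sub_add_sub_cancel _ (C c ^ (p - 1))]
    refine dvd_add (h1.trans (sub_dvd_pow_sub_pow _ _ _)) ?_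
    rw [← C_pow, ← C_1, ← map_sub]
    refine _root_.map_dvd C (dvd_pow_sub_one ?_)
    rw [hc, hp.dvd_finsetProd_iff]
    rintro ⟨t, ht, h⟩
    have := (mem_Icc.1 ht).1
    exact not_dvd_primeToPart (by omega) (Int.natCast_dvd_natCast.1 h)
  have h3 := dvd_sub_pow_of_dvd_sub (p := p) (by simpa using h2) 1
  rw [← pow_mul, pow_one, one_pow, mul_comm (p - 1)] at h3
  have h4 := sub_dvd_pow_sub_pow (A ^ (p * (p - 1))) 1 m
  rw [← pow_mul, one_pow] at h4
  refine Dvd.dvd.trans ?_ h4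
  simpa using h3

variable {k : ℕ}

/-- The product of the powers `ψ_{i + n}(x) ^ e_i`. -/
def psiWeight (p : ℕ) (e : Fin (k + 1) → ℕ) (n x : ℕ) : ℤ :=
  ∏ i : Fin (k + 1), (psi p (i + n) x : ℤ) ^ e i

/-- The digit polynomials of `psiWeight`. -/
noncomputable def psiWeightPoly (p : ℕ) (e : Fin (k + 1) → ℕ) (n a : ℕ) : ℤ[X] :=
  ∏ i : Fin (k + 1), psiPoly p (i + n) a ^ e i

theorem isWeightFamily_psiWeight (e : Fin (k + 1) → ℕ) :
    IsWeightFamily p (psiWeight p e) (psiWeightPoly p e) where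
  map_zero n := by simp [psiWeight, psi_zero_right]
  map_mul_add n y a := by
    simp only [psiWeight, psiWeightPoly, eval_prod, eval_pow, ← prod_mul_distrib,
      psi_mul_add_eq_eval, mul_pow, add_assoc]

variable {r : ℕ}

theorem exists_dvd_weightedSum_succ_sub (e : Fin (k + 1) → ℕ) (T : List (Letter p r)) {n : ℕ}
    (hn : 1 ≤ n) :
    ∃ u : ℤ, IsCoprime u p ∧ ∀ P : MvPolynomial (Fin r) ℤ, P.IsSymmetric →
      (p : ℤ) ^ (specialCount T + 1) ∣
        weightedSum (psiWeight p e (n + 1)) T P - u * weightedSum (psiWeight p e n) T P := by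
  refine (isWeightFamily_psiWeight e).exists_dvd_sub (isWeightFamily_psiWeight e).succ 1
    (fun n => ∏ i : Fin (k + 1), unitProd p (p ^ (i + n + 1)) ^ e i)
    (fun n => IsCoprime.prod_left fun i _ => (isCoprime_unitProd _).pow_left)
    (fun n hn a => ?_) T n hn
  have : C ((∏ i : Fin (k + 1), unitProd p (p ^ (i + n + 1)) ^ e i) ^ (a : ℕ)) *
      (psiWeightPoly p e n a).comp (C (p : ℤ) * X) =
      ∏ i : Fin (k + 1), (C (unitProd p (p ^ (i + n + 1)) ^ (a : ℕ)) *
        (psiPoly p (i + n) a).comp (C (p : ℤ) * X)) ^ e i := by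
    simp only [psiWeightPoly, Polynomial.prod_comp, pow_comp, mul_pow, prod_mul_distrib, ← prod_pow, map_prod,
      map_pow]
    congr 1
    exact prod_congr rfl fun i _ => pow_right_comm _ _ _
  rw [this, psiWeightPoly, Polynomial.prod_comp]
  refine dvd_prod_sub_prod _ fun i _ => ?_
  rw [pow_comp]
  exact (dvd_psiPoly_succ_sub (i := i + n) (by omega) _).trans (sub_dvd_pow_sub_pow _ _ _)

theorem exists_dvd_weightedSum_sub_of_congr {e e' m : Fin (k + 1) → ℕ}
    (h : ∀ i, e' i = e i + p * (p - 1) * m i) (T : List (Letter p r)) (n : ℕ) :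
    ∃ u : ℤ, IsCoprime u p ∧ ∀ P : MvPolynomial (Fin r) ℤ, P.IsSymmetric →
      (p : ℤ) ^ (specialCount T + 1) ∣
        weightedSum (psiWeight p e' n) T P - u * weightedSum (psiWeight p e n) T P := by
  refine (isWeightFamily_psiWeight e).exists_dvd_sub (isWeightFamily_psiWeight e') 0
    (fun _ => 1) (fun n => isCoprime_one_left) (fun n hn a => ?_) T n n.zero_le
  rw [one_pow, C_1, one_mul, psiWeightPoly, psiWeightPoly, Polynomial.prod_comp, Polynomial.prod_comp]
  refine dvd_prod_sub_prod _ fun i _ => ?_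
  rw [pow_comp, pow_comp, h, pow_add, ← mul_sub_one]
  exact (dvd_psiPoly_pow_sub_one _ _ _).mul_left _

end PsiWeight

end AbacusSum

namespace AbacusSum

open Finset

/-! ### Regularity of the language of sharp words -/

section Automaton

open MvPolynomial

variable {p r k : ℕ}

theorem dvd_iff_of_dvd_sub_mul {u S S' : ℤ} {N : ℕ} (hu : IsCoprime u p)
    (h : (p : ℤ) ^ N ∣ S' - u * S) : (p : ℤ) ^ N ∣ S' ↔ (p : ℤ) ^ N ∣ S := by
  rw [dvd_iff_dvd_of_dvd_sub h]
  exact ⟨hu.pow_right.symm.dvd_of_dvd_mul_left, fun H => H.mul_left _⟩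

variable [Fact p.Prime]

/-- The reversals of the words `T` for which the weighted sum of type `T` is not divisible by a
higher power of `p` than the number of special letters of `T` tells. -/
def sharpLanguage (e : Fin (k + 1) → ℕ) (n : ℕ) (P : MvPolynomial (Fin r) ℤ) :
    Language (Letter p r) :=
  {w | ¬ (p : ℤ) ^ (specialCount w + 1) ∣ weightedSum (psiWeight p e n) w.reverse P}

theorem mem_sharpLanguage {e : Fin (k + 1) → ℕ} {n : ℕ} {P : MvPolynomial (Fin r) ℤ}
    {w : List (Letter p r)} :
    w ∈ sharpLanguage e n P ↔
      ¬ (p : ℤ) ^ (specialCount w + 1) ∣ weightedSum (psiWeight p e n) w.reverse P :=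
  Iff.rfl

theorem sharpLanguage_succ (e : Fin (k + 1) → ℕ) {n : ℕ} (hn : 1 ≤ n)
    {P : MvPolynomial (Fin r) ℤ} (hP : P.IsSymmetric) :
    sharpLanguage (p := p) e (n + 1) P = sharpLanguage e n P := by
  ext w
  obtain ⟨u, hu, h⟩ := exists_dvd_weightedSum_succ_sub e w.reverse hn
  have := h P hP
  rw [specialCount_reverse] at this
  rw [mem_sharpLanguage, mem_sharpLanguage, dvd_iff_of_dvd_sub_mul hu this]

/-- The symmetric polynomials that are congruent modulo `p` to one of degree at most one. -/
def nearlyLinear (p r : ℕ) : Set (MvPolynomial (Fin r) ℤ) :=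
  {Q | Q.IsSymmetric ∧ ∀ m, 2 ≤ m.degree → (p : ℤ) ∣ coeff m Q}

/-- The power of p extracted by the transfer is exactly the change in the special count, so it
cancels in the sharpness condition. -/
theorem exists_leftQuotient_singleton_eq (e : Fin (k + 1) → ℕ) (n : ℕ)
    {P : MvPolynomial (Fin r) ℤ} (hP : P.IsSymmetric) (I : Letter p r) :
    ∃ Q ∈ nearlyLinear p r,
      (sharpLanguage e n P).leftQuotient [I] = sharpLanguage e (n + 1) Q := by
  have hp : (p : ℤ) ≠ 0 := by exact_mod_cast (Fact.out : p.Prime).ne_zero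
  obtain ⟨Q, hQ, hlin, h⟩ := exists_transfer_eq hp (psiWeightPoly p e n) I hP
  refine ⟨Q, ⟨hQ, hlin⟩, ?_⟩
  ext w
  rw [Language.mem_leftQuotient, mem_sharpLanguage, mem_sharpLanguage, List.singleton_append,
    List.reverse_cons, (isWeightFamily_psiWeight e).weightedSum_append, h, weightedSum_C_mul,
    ← specialCount_reverse, List.reverse_cons, specialCount_append_singleton, specialCount_reverse,
    add_right_comm, add_comm, pow_add, mul_dvd_mul_iff_left (pow_ne_zero _ hp)]

/-- The difference p D contributes p times a multiple of p ^ λ, by the lower bound for symmetric D.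
-/
theorem sharpLanguage_congr (e : Fin (k + 1) → ℕ) (n : ℕ) {P Q : MvPolynomial (Fin r) ℤ}
    (hP : P.IsSymmetric) (hQ : Q.IsSymmetric) (h : C (p : ℤ) ∣ P - Q) :
    sharpLanguage (p := p) e n P = sharpLanguage e n Q := by
  have hp : (p : ℤ) ≠ 0 := by exact_mod_cast (Fact.out : p.Prime).ne_zero
  obtain ⟨D, hD⟩ := h
  have hDs : D.IsSymmetric := isSymmetric_of_C_mul hp (hD ▸ hP.sub hQ)
  ext w
  have hS : weightedSum (psiWeight p e n) w.reverse P -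
      1 * weightedSum (psiWeight p e n) w.reverse Q =
      p * weightedSum (psiWeight p e n) w.reverse D := by
    rw [one_mul, ← weightedSum_C_mul, ← hD, sub_eq_iff_eq_add, ← weightedSum_add, sub_add_cancel]
  have hdvd := (isWeightFamily_psiWeight e).pow_specialCount_dvd w.reverse n hDs
  rw [specialCount_reverse] at hdvd
  rw [mem_sharpLanguage, mem_sharpLanguage, dvd_iff_of_dvd_sub_mul isCoprime_one_left
    (hS ▸ pow_succ' (p : ℤ) _ ▸ mul_dvd_mul_left _ hdvd)]

theorem C_dvd_sub_of_mem_nearlyLinear {P Q : MvPolynomial (Fin r) ℤ} (hP : P ∈ nearlyLinear p r)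
    (hQ : Q ∈ nearlyLinear p r) (h0 : ((coeff 0 P : ℤ) : ZMod p) = (coeff 0 Q : ℤ))
    (h1 : ∀ j, ((coeff (Finsupp.single j 1) P : ℤ) : ZMod p) = (coeff (Finsupp.single j 1) Q : ℤ)) :
    C (p : ℤ) ∣ P - Q := by
  rw [C_dvd_iff_dvd_coeff]
  intro m
  rw [coeff_sub]
  obtain hm | hm | hm : m.degree = 0 ∨ m.degree = 1 ∨ 2 ≤ m.degree := by omega
  · rw [Finsupp.degree_eq_zero_iff] at hm
    rw [hm]
    exact (ZMod.intCast_eq_intCast_iff_dvd_sub _ _ _).1 h0.symm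
  · obtain ⟨j, rfl⟩ := (Finsupp.sum_eq_one_iff m).1 hm
    exact (ZMod.intCast_eq_intCast_iff_dvd_sub _ _ _).1 (h1 j).symm
  · exact dvd_sub (hP.2 m hm) (hQ.2 m hm)

theorem finite_image_sharpLanguage (e : Fin (k + 1) → ℕ) (n : ℕ) :
    (sharpLanguage (p := p) e n '' nearlyLinear p r).Finite := by
  let κ (Q : MvPolynomial (Fin r) ℤ) : ZMod p × (Fin r → ZMod p) :=
    ((coeff 0 Q : ℤ), fun j => (coeff (Finsupp.single j 1) Q : ℤ))
  refine Set.Finite.subset (Set.finite_range fun c : κ '' nearlyLinear p r =>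
    sharpLanguage e n c.2.choose) ?_
  rintro _ ⟨Q, hQ, rfl⟩
  have h : κ Q ∈ κ '' nearlyLinear p r := ⟨Q, hQ, rfl⟩
  refine ⟨⟨κ Q, h⟩, ?_⟩
  obtain ⟨hmem, heq⟩ := h.choose_spec
  exact sharpLanguage_congr e n hmem.1 hQ.1 (C_dvd_sub_of_mem_nearlyLinear hmem hQ
    (congrArg Prod.fst heq) fun j => congrFun (congrArg Prod.snd heq) j)

theorem isRegular_sharpLanguage (e : Fin (k + 1) → ℕ) {P : MvPolynomial (Fin r) ℤ}
    (hP : P.IsSymmetric) : (sharpLanguage (p := p) e 0 P).IsRegular := by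
  -- The weight index is pinned at 1, where shifts stop mattering. The first letter read is handled
  -- separately below: it moves the index from 0 to 1 and makes the arbitrary P nearly linear.
  have key : ∀ w : List (Letter p r), ∀ Q ∈ nearlyLinear p r,
      (sharpLanguage e 1 Q).leftQuotient w ∈ sharpLanguage e 1 '' nearlyLinear p r := by
    intro w
    induction w with
    | nil => exact fun Q hQ => ⟨Q, hQ, rfl⟩
    | cons I w ih =>
      intro Q hQ
      obtain ⟨R, hR, h⟩ := exists_leftQuotient_singleton_eq e 1 hQ.1 I
      rw [← List.singleton_append, Language.leftQuotient_append, h,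
        sharpLanguage_succ e le_rfl hR.1]
      exact ih R hR
  refine Language.IsRegular.of_finite_range_leftQuotient
    (((finite_image_sharpLanguage (r := r) e 1).insert (sharpLanguage e 0 P)).subset ?_)
  rintro _ ⟨w, rfl⟩
  cases w with
  | nil => exact Set.mem_insert _ _
  | cons I w =>
    obtain ⟨Q, hQ, h⟩ := exists_leftQuotient_singleton_eq e 0 hP I
    rw [← List.singleton_append, Language.leftQuotient_append, h]
    exact Set.mem_insert_of_mem _ (key w Q hQ)

end Automaton

/-! ### Passing from natural to integer exponents -/

section Rational

variable {p : ℕ}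

theorem exponent_eq_iff (q : ℚ) (l : ℕ) :
    exponent p q = ((l : ℤ) : WithTop ℤ) ↔
      ((l : ℤ) : WithTop ℤ) ≤ exponent p q ∧ ¬ (((l + 1 : ℕ) : ℤ) : WithTop ℤ) ≤ exponent p q := by
  cases exponent p q with
  | top => simp
  | coe v =>
    rw [WithTop.coe_le_coe, WithTop.coe_le_coe, WithTop.coe_inj]
    omega

variable [Fact p.Prime]

theorem le_exponent_iff (q : ℚ) (l : ℕ) :
    ((l : ℤ) : WithTop ℤ) ≤ exponent p q ↔ padicNorm p q ≤ (p : ℚ) ^ (-l : ℤ) := by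
  have hp := (Fact.out : p.Prime)
  rw [exponent]
  split_ifs with hq
  · simp only [le_top, true_iff, hq, padicNorm.zero]
    positivity
  · rw [WithTop.coe_le_coe, padicNorm.eq_zpow_of_nonzero hq,
      zpow_le_zpow_iff_right₀ (by exact_mod_cast hp.one_lt), neg_le_neg_iff]

theorem le_exponent_iff_dvd {q : ℚ} {z : ℤ} {N l : ℕ} (hl : l ≤ N)
    (h : padicNorm p (q - z) ≤ (p : ℚ) ^ (-N : ℤ)) :
    ((l : ℤ) : WithTop ℤ) ≤ exponent p q ↔ (p : ℤ) ^ l ∣ z := by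
  have hp := (Fact.out : p.Prime)
  have h' : padicNorm p (q - z) ≤ (p : ℚ) ^ (-l : ℤ) :=
    h.trans (zpow_le_zpow_right₀ (by exact_mod_cast hp.one_le) (by omega))
  have hd : (p : ℤ) ^ l ∣ z ↔ padicNorm p z ≤ (p : ℚ) ^ (-l : ℤ) := by
    rw [← padicNorm.dvd_iff_norm_le]
    push_cast
    rfl
  rw [le_exponent_iff, hd]
  constructor
  · intro H
    have := padicNorm.sub (p := p) (q := q) (r := q - z)
    rw [sub_sub_cancel] at this
    exact this.trans (max_le H h')
  · intro H
    have := padicNorm.nonarchimedean (p := p) (q := q - z) (r := z)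
    rw [sub_add_cancel] at this
    exact this.trans (max_le h' H)

variable {k r : ℕ}

/-- Nonnegative exponents that agree with `e` modulo `(p - 1) p ^ N`. -/
def natExponents (p N : ℕ) (e : Fin (k + 1) → ℤ) (i : Fin (k + 1)) : ℕ :=
  (e i + (p - 1) * p ^ N * (e i).natAbs).toNat

theorem natExponents_cast (N : ℕ) (e : Fin (k + 1) → ℤ) (i : Fin (k + 1)) :
    (natExponents p N e i : ℤ) = e i + ((p - 1) * p ^ N * (e i).natAbs : ℕ) := by
  have hp := (Fact.out : p.Prime)
  have h1 : 1 ≤ (p - 1) * p ^ N :=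
    Nat.mul_pos (Nat.sub_pos_of_lt hp.one_lt) (pow_pos hp.pos _)
  have h2 : (e i).natAbs ≤ (p - 1) * p ^ N * (e i).natAbs := Nat.le_mul_of_pos_left _ h1
  have h3 : (((p - 1) * p ^ N * (e i).natAbs : ℕ) : ℤ) = (p - 1) * p ^ N * (e i).natAbs := by
    push_cast [Nat.cast_sub hp.one_le]
    rfl
  rw [natExponents, ← h3]
  omega

theorem natExponents_succ (N : ℕ) (e : Fin (k + 1) → ℤ) (i : Fin (k + 1)) :
    natExponents p (N + 1) e i =
      natExponents p 1 e i + p * (p - 1) * ((p ^ N - 1) * (e i).natAbs) := by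
  have hp := (Fact.out : p.Prime)
  zify
  rw [natExponents_cast, natExponents_cast]
  push_cast [Nat.cast_sub hp.one_le, Nat.cast_sub (Nat.one_le_pow N p hp.pos)]
  ring

theorem padicNorm_prod_zpow_eq_one {ι : Type*} (s : Finset ι) {b : ι → ℚ}
    (hb : ∀ i ∈ s, padicNorm p (b i) = 1) (e : ι → ℤ) :
    padicNorm p (∏ i ∈ s, b i ^ e i) = 1 := by
  let φ : ℚ →*₀ ℚ :=
    { toFun := padicNorm p
      map_zero' := padicNorm.zero
      map_one' := padicNorm.one
      map_mul' := padicNorm.mul }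
  change φ _ = 1
  rw [map_prod]
  refine prod_eq_one fun i hi => ?_
  rw [map_zpow₀, show φ (b i) = 1 from hb i hi, one_zpow]

theorem pow_dvd_pow_sub_one {c : ℤ} (hc : ¬ (p : ℤ) ∣ c) (N : ℕ) :
    (p : ℤ) ^ N ∣ c ^ ((p - 1) * p ^ N) - 1 := by
  have := dvd_sub_pow_of_dvd_sub (dvd_pow_sub_one hc) N
  rw [one_pow, ← pow_mul] at this
  exact (pow_dvd_pow _ N.le_succ).trans this

theorem padicNorm_summand_sub_le (e : Fin (k + 1) → ℤ) (P : MvPolynomial (Fin r) ℤ) (N : ℕ)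
    (x : Fin r → ℕ) :
    padicNorm p (summand p e P x - ((MvPolynomial.eval (fun j => (x j : ℤ)) P *
      ∏ j, psiWeight p (natExponents p N e) 0 (x j) : ℤ) : ℚ)) ≤ (p : ℚ) ^ (-N : ℤ) := by
  have hp := Nat.prime_iff_prime_int.1 (Fact.out : p.Prime)
  let b (i : Fin (k + 1)) : ℤ := ∏ j, (psi p i (x j) : ℤ)
  have hb (i : Fin (k + 1)) : ¬ (p : ℤ) ∣ b i := by
    rw [hp.dvd_finsetProd_iff]
    rintro ⟨j, -, h⟩
    exact not_dvd_psi _ _ (Int.natCast_dvd_natCast.1 h)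
  have hb0 (i : Fin (k + 1)) : (b i : ℚ) ≠ 0 := by
    have : b i ≠ 0 := fun h => hb i (h ▸ dvd_zero _)
    exact_mod_cast this
  -- Raising the exponents to `natExponents p N e` multiplies the product by D ^ ((p - 1) p ^ N),
  -- which is 1 modulo p ^ N.
  let D : ℤ := ∏ i, b i ^ (e i).natAbs
  have hD : ¬ (p : ℤ) ∣ D := by
    rw [hp.dvd_finsetProd_iff]
    rintro ⟨i, -, h⟩
    exact hb i (hp.dvd_of_dvd_pow h)
  have hprod : ((∏ j, psiWeight p (natExponents p N e) 0 (x j) : ℤ) : ℚ) =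
      (∏ i, (b i : ℚ) ^ e i) * (D ^ ((p - 1) * p ^ N) : ℤ) := by
    simp only [psiWeight, add_zero]
    rw [prod_comm]
    simp only [prod_pow]
    push_cast [D]
    rw [← prod_pow, ← prod_mul_distrib]
    refine prod_congr rfl fun i _ => ?_
    rw [← pow_mul, mul_comm (e i).natAbs, ← zpow_natCast _ ((p - 1) * p ^ N * (e i).natAbs),
      ← zpow_add₀ (hb0 i), ← natExponents_cast, zpow_natCast]
    simp [b]
  have hsum : summand p e P x = ((MvPolynomial.eval (fun j => (x j : ℤ)) P : ℤ) : ℚ) *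
      ∏ i, (b i : ℚ) ^ e i := by
    simp [summand, b]
  have hdiff : summand p e P x - ((MvPolynomial.eval (fun j => (x j : ℤ)) P *
      ∏ j, psiWeight p (natExponents p N e) 0 (x j) : ℤ) : ℚ) =
      (∏ i, (b i : ℚ) ^ e i) * ((MvPolynomial.eval (fun j => (x j : ℤ)) P *
        -(D ^ ((p - 1) * p ^ N) - 1) : ℤ) : ℚ) := by
    rw [Int.cast_mul, hprod, hsum]
    push_cast
    ring
  rw [hdiff, padicNorm.mul, padicNorm_prod_zpow_eq_one _
    (fun i _ => (padicNorm.int_eq_one_iff _).2 (hb i)), one_mul, ← padicNorm.dvd_iff_norm_le]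
  push_cast
  exact ((pow_dvd_pow_sub_one hD N).neg_right).mul_left _

theorem padicNorm_abacusSum_sub_le (e : Fin (k + 1) → ℤ) (T : List (Letter p r))
    (P : MvPolynomial (Fin r) ℤ) (N : ℕ) :
    padicNorm p (abacusSum p e T P - weightedSum (psiWeight p (natExponents p N e) 0) T P) ≤
      (p : ℚ) ^ (-N : ℤ) := by
  rw [abacusSum, weightedSum, Int.cast_sum, ← sum_sub_distrib]
  exact padicNorm.sum_le' (fun x _ => padicNorm_summand_sub_le e P N x) (by positivity)

theorem le_exponent_abacusSum_and_eq_iff (e : Fin (k + 1) → ℤ) (T : List (Letter p r))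
    {P : MvPolynomial (Fin r) ℤ} (hP : P.IsSymmetric) :
    ((specialCount T : ℤ) : WithTop ℤ) ≤ exponent p (abacusSum p e T P) ∧
      (exponent p (abacusSum p e T P) = ((specialCount T : ℤ) : WithTop ℤ) ↔
        T.reverse ∈ sharpLanguage (natExponents p 1 e) 0 P) := by
  -- Precision λ(T) + 1 decides divisibility by both p ^ λ(T) and p ^ (λ(T) + 1).
  have hN := padicNorm_abacusSum_sub_le e T P (specialCount T + 1)
  have hle := (le_exponent_iff_dvd (Nat.le_succ _) hN).2
    ((isWeightFamily_psiWeight _).pow_specialCount_dvd T 0 hP)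
  refine ⟨hle, ?_⟩
  -- The exponents just used depend on T; exchanging them for `natExponents p 1 e` makes the
  -- language the same for all T.
  obtain ⟨u, hu, h⟩ := exists_dvd_weightedSum_sub_of_congr (p := p)
    (natExponents_succ (p := p) (specialCount T) e) T 0
  rw [exponent_eq_iff, and_iff_right hle, le_exponent_iff_dvd le_rfl hN,
    dvd_iff_of_dvd_sub_mul hu (h P hP), mem_sharpLanguage, specialCount_reverse, List.reverse_reverse]

end Rational

end AbacusSum

theorem lemma5p6 (p : ℕ) [Fact p.Prime] (r : ℕ) (hr : 0 < r) (k : ℕ) (e : Fin (k + 1) → ℤ)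
    (P : MvPolynomial (Fin r) ℤ) (hP : P.IsSymmetric) :
    (∀ T : List (AbacusSum.Letter p r),
      ((AbacusSum.specialCount T : ℤ) : WithTop ℤ) ≤
        AbacusSum.exponent p (AbacusSum.abacusSum p e T P)) ∧
    ∃ (σ : Type) (_ : Fintype σ) (M : DFA (AbacusSum.Letter p r) σ),
      ∀ T : List (AbacusSum.Letter p r),
        AbacusSum.exponent p (AbacusSum.abacusSum p e T P) =
            ((AbacusSum.specialCount T : ℤ) : WithTop ℤ) ↔
          AbacusSum.AcceptsFromRight M T := by
  refine ⟨fun T => (AbacusSum.le_exponent_abacusSum_and_eq_iff e T hP).1, ?_⟩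
  obtain ⟨σ, hσ, M, hM⟩ := AbacusSum.isRegular_sharpLanguage (p := p) (AbacusSum.natExponents p 1 e) hP
  refine ⟨σ, hσ, M, fun T => ?_⟩
  rw [AbacusSum.AcceptsFromRight, hM]
  exact (AbacusSum.le_exponent_abacusSum_and_eq_iff e T hP).2
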